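/- For a subset $K$ of a normed space $X$ and $n\ge 0$, let the entropy number $\varepsilon_n(K)_X$ be the infimum of all $\varepsilon>0$ for which $K$ can be covered by $2^n$ balls of $X$ of radius $\varepsilon$. Let $\ell_\infty(\Gamma)$ be the space of bounded real-valued functions on a set $\Gamma$ with the supremum norm, and $\ell_\infty^m$ the space $\mathbb{R}^m$ with the maximum norm. There is an absolute constant $C>0$ (not depending on $X$, $\Gamma$, $K$ or $n$) such that the following holds. Let $X$ be a real Banach space that is isometric to $\ell_\infty(\Gamma)$ for some set $\Gamma$, and let $K\subset X$ be compact. Then for each $n\ge 1$ there are mappings $$a_n:X\to \ell_\infty^{26n},\qquad M_n:\ell_\infty^{26n}\to X,$$ both Lipschitz with constant $Cn^{3/4}$, such that $$\sup_{f\in K}\|f-M_n(a_n(f))\|_X\le C\,n^{3/2}\,\varepsilon_n(K)_X .$$ -/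

import Mathlib

open scoped NNReal ENNReal

/-- The `n`-th entropy number of a subset `K` of a metric space `X`: the infimum of all `ε > 0` for
which `K` is covered by `2 ^ n` balls of radius `ε` (centres anywhere in `X`, repetitions allowed).
For bounded `K` the set of such `ε` is nonempty, so the real infimum is not a default value. -/
noncomputable def entropyNumber {X : Type*} [PseudoMetricSpace X] (n : ℕ) (K : Set X) : ℝ :=
  sInf {ε : ℝ | 0 < ε ∧ ∃ c : Fin (2 ^ n) → X, K ⊆ ⋃ i, Metric.closedBall (c i) ε}

/-! Some set `S` of at most `2 ^ n` points approximates `K` within twice the entropy number. If the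
identity of `S` factors through `ℓ_∞^{26 n}` by maps with Lipschitz constants of order `n ^ (3 /
4)`, both maps extend globally without loss, because each takes values in an `ℓ_∞` space and real
Lipschitz functions extend. The error at `f` is then at most one plus the product of the constants,
times the distance from `f` to `S`.

The factorization comes from `exists_embedding_pi`, a variant of Bourgain's embedding. A random set
of density `2 ^ (-(j + 1))` detects the increment `δ j` of Bourgain's radii for a pair with fixed
probability. These increments sum to half the distance, so by Cauchy–Schwarz their squares sum to at
least `dist x y ^ 2 / (4 * n)`. Summing the distances to `32` such sets per scale with random signs
gives one coordinate: it is `32 * n`-Lipschitz, and by Paley–Zygmund it separates a given pair by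
`dist x y / (4 * √n)` with probability at least `1 / 15`. A union bound over pairs shows that `26 *
n` independent coordinates suffice. -/

/-! ### Moments of Rademacher sums and the union bound. -/

/-- The signed sum `∑ ± t i` with positive signs exactly on `T`. -/
noncomputable def signedSum {ι : Type*} [DecidableEq ι] (s : Finset ι) (t : ι → ℝ)
    (T : Finset ι) : ℝ :=
  ∑ i ∈ s, if i ∈ T then t i else -t i

section Signs

variable {ι : Type*} [DecidableEq ι]

lemma signedSum_insert_of_notMem {s : Finset ι} {a : ι} (ha : a ∉ s) (t : ι → ℝ)
    {T : Finset ι} (hT : T ⊆ s) : signedSum (insert a s) t T = -t a + signedSum s t T := by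
  have haT : a ∉ T := fun h => ha (hT h)
  simp [signedSum, Finset.sum_insert ha, haT]

lemma signedSum_insert_insert {s : Finset ι} {a : ι} (ha : a ∉ s) (t : ι → ℝ)
    (T : Finset ι) : signedSum (insert a s) t (insert a T) = t a + signedSum s t T := by
  simp only [signedSum, Finset.sum_insert ha, Finset.mem_insert_self, if_true]
  congr 1
  refine Finset.sum_congr rfl fun i hi => ?_
  have : i ≠ a := fun h => ha (h ▸ hi)
  simp [this]

lemma sum_signedSum_sq (s : Finset ι) (t : ι → ℝ) :
    ∑ T ∈ s.powerset, signedSum s t T ^ 2 = 2 ^ s.card * ∑ i ∈ s, t i ^ 2 := by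
  induction s using Finset.induction_on with
  | empty => simp [signedSum]
  | insert a s ha ih =>
    rw [Finset.sum_powerset_insert ha, ← Finset.sum_add_distrib]
    have : ∀ T ∈ s.powerset, signedSum (insert a s) t T ^ 2
        + signedSum (insert a s) t (insert a T) ^ 2 = 2 * signedSum s t T ^ 2 + 2 * t a ^ 2 := by
      intro T hT
      rw [signedSum_insert_of_notMem ha t (Finset.mem_powerset.1 hT),
        signedSum_insert_insert ha]
      ring
    rw [Finset.sum_congr rfl this, Finset.sum_add_distrib, ← Finset.mul_sum, ih,
      Finset.card_insert_of_notMem ha, Finset.sum_insert ha, Finset.sum_const,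
      Finset.card_powerset, nsmul_eq_mul]
    push_cast
    ring

/-- Averaging over the sign of a new term kills the odd powers; what remains is dominated by the
expansion of `3 * (V + t a ^ 2) ^ 2`, where `V` is the old sum of squares. -/
lemma sum_signedSum_pow_four_le (s : Finset ι) (t : ι → ℝ) :
    ∑ T ∈ s.powerset, signedSum s t T ^ 4 ≤ 2 ^ s.card * (3 * (∑ i ∈ s, t i ^ 2) ^ 2) := by
  induction s using Finset.induction_on with
  | empty => simp [signedSum]
  | insert a s ha ih =>
    rw [Finset.sum_powerset_insert ha, ← Finset.sum_add_distrib]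
    have : ∀ T ∈ s.powerset, signedSum (insert a s) t T ^ 4
        + signedSum (insert a s) t (insert a T) ^ 4
        = 2 * signedSum s t T ^ 4 + 12 * t a ^ 2 * signedSum s t T ^ 2 + 2 * t a ^ 4 := by
      intro T hT
      rw [signedSum_insert_of_notMem ha t (Finset.mem_powerset.1 hT),
        signedSum_insert_insert ha]
      ring
    rw [Finset.sum_congr rfl this, Finset.sum_add_distrib, Finset.sum_add_distrib,
      ← Finset.mul_sum, ← Finset.mul_sum, sum_signedSum_sq,
      Finset.card_insert_of_notMem ha, Finset.sum_insert ha, Finset.sum_const,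
      Finset.card_powerset, nsmul_eq_mul]
    push_cast
    have h : (0 : ℝ) ≤ 2 ^ s.card * t a ^ 4 := by positivity
    rw [pow_succ 2 s.card]
    nlinarith

/-- Paley–Zygmund inequality for Rademacher sums, in counting form. -/
lemma card_le_twelve_mul_card_signedSum_sq_ge [Fintype ι] (t : ι → ℝ) :
    (Fintype.card (Finset ι) : ℝ) ≤ 12 * (Finset.univ.filter fun T : Finset ι =>
      (∑ i, t i ^ 2) / 2 ≤ signedSum Finset.univ t T ^ 2).card := by
  classical
  set V := ∑ i, t i ^ 2 with hV
  set G := Finset.univ.filter fun T : Finset ι => V / 2 ≤ signedSum Finset.univ t T ^ 2 with hG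
  have hV0 : 0 ≤ V := Finset.sum_nonneg fun i _ => sq_nonneg _
  have hcard : (Fintype.card (Finset ι) : ℝ) = 2 ^ (Finset.univ : Finset ι).card := by
    simp
  rcases hV0.eq_or_lt with h0 | hpos
  · have : G = Finset.univ := by
      rw [hG, Finset.filter_true_of_mem]
      intro T _
      rw [← h0]
      simpa using sq_nonneg _
    rw [this, Finset.card_univ]
    have : (0 : ℝ) ≤ Fintype.card (Finset ι) := by positivity
    linarith
  have h2 := sum_signedSum_sq Finset.univ t
  have h4 := sum_signedSum_pow_four_le Finset.univ t
  rw [Finset.powerset_univ, ← hV, ← hcard] at h2 h4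
  set N : ℝ := ((Fintype.card (Finset ι) : ℕ) : ℝ) with hN
  have hNpos : 0 < N := by rw [hcard]; positivity
  have hsplit := Finset.sum_filter_add_sum_filter_not Finset.univ
    (fun T : Finset ι => V / 2 ≤ signedSum Finset.univ t T ^ 2)
    (fun T => signedSum Finset.univ t T ^ 2)
  have hsmall : ∑ T with ¬ V / 2 ≤ signedSum Finset.univ t T ^ 2,
      signedSum Finset.univ t T ^ 2 ≤ N * (V / 2) := by
    calc _ ≤ ∑ T with ¬ V / 2 ≤ signedSum Finset.univ t T ^ 2, V / 2 :=
          Finset.sum_le_sum fun T hT => (not_le.1 (Finset.mem_filter.1 hT).2).le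
      _ ≤ ∑ _T : Finset ι, V / 2 :=
          Finset.sum_le_sum_of_subset_of_nonneg (Finset.subset_univ _)
            fun _ _ _ => by positivity
      _ = N * (V / 2) := by simp [hN]
  have hbig : N * (V / 2) ≤ ∑ T ∈ G, signedSum Finset.univ t T ^ 2 := by
    rw [hG]; linarith
  -- Cauchy–Schwarz on `G` plays the second moment against the fourth: `(N * V / 2) ^ 2 ≤ G.card * 3
  -- * N * V ^ 2`, whence the factor `12`.
  have hcs := sq_sum_le_card_mul_sum_sq (s := G) (f := fun T => signedSum Finset.univ t T ^ 2)
  have h4' : ∑ T ∈ G, (signedSum Finset.univ t T ^ 2) ^ 2 ≤ N * (3 * V ^ 2) := by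
    refine le_trans (Finset.sum_le_sum_of_subset_of_nonneg (Finset.subset_univ _)
      fun _ _ _ => by positivity) (le_trans (le_of_eq ?_) h4)
    exact Finset.sum_congr rfl fun T _ => by ring
  have hsq : (N * (V / 2)) ^ 2 ≤ G.card * (N * (3 * V ^ 2)) :=
    (pow_le_pow_left₀ (by positivity) hbig 2).trans
      (hcs.trans (mul_le_mul_of_nonneg_left h4' (by positivity)))
  have hpos' : 0 < N * V ^ 2 / 4 := by positivity
  refine le_of_mul_le_mul_right ?_ hpos'
  linarith

end Signs

/-- The union bound for `m` independent uniform trials, in counting form. -/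
lemma exists_forall_exists_notMem {Q Ω : Type*} [Fintype Ω] [Nonempty Ω] [DecidableEq Ω]
    (s : Finset Q) (bad : Q → Finset Ω) (p : ℝ) (m : ℕ)
    (hbad : ∀ q ∈ s, ((bad q).card : ℝ) ≤ p * Fintype.card Ω) (hs : s.card * p ^ m < 1) :
    ∃ ω : Fin m → Ω, ∀ q ∈ s, ∃ k, ω k ∉ bad q := by
  classical
  by_contra! hcon
  have hsub : (Finset.univ : Finset (Fin m → Ω)) ⊆
      s.biUnion fun q => Fintype.piFinset fun _ => bad q := by
    intro ω _
    obtain ⟨q, hq, h⟩ := hcon ω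
    exact Finset.mem_biUnion.2 ⟨q, hq, Fintype.mem_piFinset.2 h⟩
  have hcard := (Finset.card_le_card hsub).trans Finset.card_biUnion_le
  have hΩ : (0 : ℝ) < (Fintype.card Ω : ℝ) ^ m := by
    have : 0 < Fintype.card Ω := Fintype.card_pos
    positivity
  have hle : (Fintype.card Ω : ℝ) ^ m ≤ s.card * p ^ m * (Fintype.card Ω : ℝ) ^ m := by
    have h1 : ((Fintype.card Ω : ℝ)) ^ m
        ≤ ∑ q ∈ s, ((bad q).card : ℝ) ^ m := by
      have := (Nat.cast_le (α := ℝ)).2 hcard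
      simpa [Fintype.card_piFinset] using this
    refine h1.trans ((Finset.sum_le_sum fun q hq =>
      pow_le_pow_left₀ (by positivity) (hbad q hq) m).trans (le_of_eq ?_))
    rw [Finset.sum_const, nsmul_eq_mul, mul_pow, mul_assoc]
  nlinarith

/-! ### Bourgain's radii. -/

section Scales

variable {P : Type*} [Fintype P] [MetricSpace P]

/-- Bourgain's radii for a pair of points: the least radii, capped at half the distance, at which
both closed balls contain at least `2 ^ j` points. -/
lemma exists_bourgain_radii {n : ℕ} (hP : Fintype.card P ≤ 2 ^ n) {x y : P} (hxy : x ≠ y) :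
    ∃ r : ℕ → ℝ, r 0 = 0 ∧ r n = dist x y / 2 ∧ Monotone r ∧ (∀ j, r j ≤ dist x y / 2) ∧
      (∀ j, r j < dist x y / 2 →
        2 ^ j ≤ (Finset.univ.filter fun z => dist x z ≤ r j).card ∧
        2 ^ j ≤ (Finset.univ.filter fun z => dist y z ≤ r j).card) ∧
      ∀ j, (Finset.univ.filter fun z => dist x z < r j).card < 2 ^ j ∨
        (Finset.univ.filter fun z => dist y z < r j).card < 2 ^ j := by
  classical
  have hd : 0 < dist x y := dist_pos.2 hxy
  -- Ball counts change only at these finitely many radii, so least radii exist within `D`.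
  set D : Finset ℝ := insert (dist x y / 2)
    (Finset.univ.image (dist x) ∪ Finset.univ.image (dist y)) with hD
  have hDx : ∀ z, dist x z ∈ D := fun z => by simp [hD]
  have hDy : ∀ z, dist y z ∈ D := fun z => by simp [hD]
  have hD0 : ∀ ρ ∈ D, 0 ≤ ρ := by
    intro ρ hρ
    simp only [hD, Finset.mem_insert, Finset.mem_union, Finset.mem_image, Finset.mem_univ,
      true_and] at hρ
    rcases hρ with h | ⟨z, h⟩ | ⟨z, h⟩
    · rw [h]; positivity
    · rw [← h]; exact dist_nonneg
    · rw [← h]; exact dist_nonneg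
  let good : ℕ → ℝ → Prop := fun j ρ => ρ = dist x y / 2 ∨ (ρ ≤ dist x y / 2 ∧
      2 ^ j ≤ (Finset.univ.filter fun z => dist x z ≤ ρ).card ∧
      2 ^ j ≤ (Finset.univ.filter fun z => dist y z ≤ ρ).card)
  have hex : ∀ j, ∃ ρ ∈ D, good j ρ ∧ ∀ ρ' ∈ D, good j ρ' → ρ ≤ ρ' := by
    intro j
    obtain ⟨ρ, hρ, hmin⟩ := Finset.exists_min_image (D.filter (good j)) id
      ⟨dist x y / 2, Finset.mem_filter.2 ⟨by simp [hD], Or.inl rfl⟩⟩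
    rw [Finset.mem_filter] at hρ
    exact ⟨ρ, hρ.1, hρ.2, fun ρ' h h' => hmin ρ' (Finset.mem_filter.2 ⟨h, h'⟩)⟩
  choose r hrD hgood hmin using hex
  have hle : ∀ j, r j ≤ dist x y / 2 := fun j => (hgood j).elim le_of_eq fun h => h.1
  have hcount : ∀ j, r j < dist x y / 2 →
        2 ^ j ≤ (Finset.univ.filter fun z => dist x z ≤ r j).card ∧
        2 ^ j ≤ (Finset.univ.filter fun z => dist y z ≤ r j).card :=
    fun j hj => ((hgood j).resolve_left hj.ne).2
  refine ⟨r, ?_, ?_, ?_, hle, hcount, ?_⟩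
  · refine le_antisymm (hmin 0 0 ?_ (Or.inr ⟨by positivity, ?_, ?_⟩)) (hD0 _ (hrD 0))
    · simpa using hDx x
    · rw [pow_zero, Nat.one_le_iff_ne_zero, Finset.card_ne_zero]
      exact ⟨x, by simp⟩
    · rw [pow_zero, Nat.one_le_iff_ne_zero, Finset.card_ne_zero]
      exact ⟨y, by simp⟩
  · by_contra hne
    -- Otherwise the ball about `x` would contain all of `P`, including `y`, at a radius below half
    -- the distance.
    have hlt := lt_of_le_of_ne (hle n) hne
    have huniv := Finset.eq_univ_of_card (Finset.univ.filter fun z => dist x z ≤ r n)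
      (le_antisymm (Finset.card_le_univ _) (hP.trans (hcount n hlt).1))
    have : y ∈ Finset.univ.filter fun z => dist x z ≤ r n := by
      rw [huniv]; exact Finset.mem_univ y
    have := (Finset.mem_filter.1 this).2
    linarith
  · refine monotone_nat_of_le_succ fun j => hmin j _ (hrD (j + 1)) ?_
    have hpow : 2 ^ j ≤ 2 ^ (j + 1) := Nat.pow_le_pow_right (by norm_num) (by omega)
    exact (hgood (j + 1)).imp id fun h => ⟨h.1, hpow.trans h.2.1, hpow.trans h.2.2⟩
  · intro j
    by_contra! hcon
    obtain ⟨hx, hy⟩ := hcon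
    -- The largest distance in `E` would be an admissible radius smaller than `r j`.
    set E : Finset ℝ := (Finset.univ.filter fun z => dist x z < r j).image (dist x) ∪
      (Finset.univ.filter fun z => dist y z < r j).image (dist y) with hE
    have hEne : E.Nonempty := by
      have : (Finset.univ.filter fun z => dist x z < r j).Nonempty :=
        Finset.card_pos.1 (lt_of_lt_of_le (by positivity) hx)
      exact (this.image _).mono Finset.subset_union_left
    have hED : ∀ e ∈ E, e ∈ D ∧ e < r j := by
      intro e he
      simp only [hE, Finset.mem_union, Finset.mem_image, Finset.mem_filter, Finset.mem_univ,
        true_and] at he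
      rcases he with ⟨z, hz, rfl⟩ | ⟨z, hz, rfl⟩
      · exact ⟨hDx z, hz⟩
      · exact ⟨hDy z, hz⟩
    obtain ⟨hmD, hmr⟩ := hED _ (E.max'_mem hEne)
    refine absurd (hmin j _ hmD (Or.inr ⟨(hmr.trans_le (hle j)).le, hx.trans ?_, hy.trans ?_⟩))
      (not_le.2 hmr)
    · refine Finset.card_le_card fun z hz => ?_
      exact Finset.mem_filter.2 ⟨Finset.mem_univ _, E.le_max' _
        (Finset.mem_union_left _ (Finset.mem_image_of_mem _ hz))⟩
    · refine Finset.card_le_card fun z hz => ?_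
      exact Finset.mem_filter.2 ⟨Finset.mem_univ _, E.le_max' _
        (Finset.mem_union_right _ (Finset.mem_image_of_mem _ hz))⟩

end Scales

/-! ### Random subsets of prescribed density. -/

section RandomSets

variable {P : Type*} [Fintype P] [DecidableEq P]

/-- Labels of distinct points are independent and uniform, so the count is a product over the
points. -/
lemma card_forall_le_apply {m h : ℕ} (hm : 0 < m) (hh : h ≤ m) (S : Finset P) :
    ((Finset.univ.filter fun ω : P → Fin m => ∀ z ∈ S, h ≤ (ω z : ℕ)).card : ℝ)
      = (m : ℝ) ^ Fintype.card P * (1 - h / m) ^ S.card := by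
  have hset : (Finset.univ.filter fun ω : P → Fin m => ∀ z ∈ S, h ≤ (ω z : ℕ))
      = Fintype.piFinset fun z => if z ∈ S then
          Finset.univ.filter (fun v : Fin m => h ≤ (v : ℕ)) else Finset.univ := by
    ext ω
    simp only [Finset.mem_filter, Finset.mem_univ, true_and, Fintype.mem_piFinset]
    refine forall_congr' fun z => ?_
    by_cases hz : z ∈ S <;> simp [hz]
  have hcard : ((Finset.univ.filter (fun v : Fin m => h ≤ (v : ℕ))).card : ℝ)
      = m * (1 - h / m) := by
    have h1 : (Finset.univ.filter (fun v : Fin m => ¬ (v : ℕ) < h)).card = m - h := by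
      have h2 := Finset.card_filter_add_card_filter_not (s := (Finset.univ : Finset (Fin m)))
        (fun v : Fin m => (v : ℕ) < h)
      have h3 := Fin.card_filter_val_lt (n := m) (m := h)
      rw [Finset.card_univ, Fintype.card_fin] at h2
      omega
    simp only [not_lt] at h1
    rw [h1, Nat.cast_sub hh]
    have : (m : ℝ) ≠ 0 := by positivity
    field_simp
  rw [hset, Fintype.card_piFinset, Nat.cast_prod]
  have : ∀ z, (((if z ∈ S then Finset.univ.filter (fun v : Fin m => h ≤ (v : ℕ))
      else Finset.univ).card : ℕ) : ℝ) = m * (if z ∈ S then (1 - h / m : ℝ) else 1) := by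
    intro z
    by_cases hz : z ∈ S
    · simp only [hz, if_true]; exact hcard
    · simp [hz]
  simp_rw [this]
  rw [Finset.prod_mul_distrib, Finset.prod_const, Finset.card_univ, Finset.prod_ite_mem,
    Finset.univ_inter, Finset.prod_const]

/-- A random subset of density `2 ^ (-(j + 1))` misses a set of fewer than `2 ^ (j + 1)` points and
meets a disjoint set of at least `2 ^ j` points with probability at least `1 / 12`. -/
lemma card_le_twelve_mul_card_miss_hit {n j : ℕ} (hj : j < n) {S T : Finset P}
    (hST : Disjoint S T) (hS : S.card < 2 ^ (j + 1)) (hT : 2 ^ j ≤ T.card) :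
    (Fintype.card (P → Fin (2 ^ n)) : ℝ) ≤
      12 * (Finset.univ.filter fun ω : P → Fin (2 ^ n) =>
        (∀ z ∈ S, 2 ^ (n - (j + 1)) ≤ (ω z : ℕ)) ∧
          ∃ z ∈ T, (ω z : ℕ) < 2 ^ (n - (j + 1))).card := by
  set h := 2 ^ (n - (j + 1)) with hh
  have hle : h ≤ 2 ^ n := Nat.pow_le_pow_right (by norm_num) (Nat.sub_le _ _)
  have hsplit := Finset.card_filter_add_card_filter_not
    (s := Finset.univ.filter fun ω : P → Fin (2 ^ n) => ∀ z ∈ S, h ≤ (ω z : ℕ))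
    (fun ω => ∃ z ∈ T, (ω z : ℕ) < h)
  rw [Finset.filter_filter, Finset.filter_filter] at hsplit
  have hunion : (Finset.univ.filter fun ω : P → Fin (2 ^ n) =>
      (∀ z ∈ S, h ≤ (ω z : ℕ)) ∧ ¬ ∃ z ∈ T, (ω z : ℕ) < h)
      = Finset.univ.filter fun ω : P → Fin (2 ^ n) => ∀ z ∈ S ∪ T, h ≤ (ω z : ℕ) := by
    ext ω
    simp only [Finset.mem_filter, Finset.mem_univ, true_and, Finset.mem_union, not_exists,
      not_and, not_lt, or_imp, forall_and]
  rw [hunion] at hsplit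
  have hsplit' := congrArg (Nat.cast (R := ℝ)) hsplit
  push_cast at hsplit'
  rw [card_forall_le_apply (by positivity) hle, card_forall_le_apply (by positivity) hle,
    Finset.card_union_of_disjoint hST, pow_add] at hsplit'
  have hq : ((h : ℕ) : ℝ) / ((2 ^ n : ℕ) : ℝ) = 1 / 2 ^ (j + 1) := by
    rw [hh]
    push_cast
    rw [div_eq_div_iff (by positivity) (by positivity), one_mul, ← pow_add]
    congr 1
    omega
  rw [hq] at hsplit'
  set q : ℝ := 1 / 2 ^ (j + 1) with hqdef
  have hq0 : 0 < q := by positivity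
  have hqj : (2 : ℝ) ^ j * q = 1 / 2 := by
    rw [hqdef, pow_succ]
    field_simp
  have hq1 : q ≤ 1 / 2 := by
    have : (1 : ℝ) ≤ 2 ^ j := one_le_pow₀ (by norm_num)
    nlinarith
  -- Bernoulli's inequality with `2 ^ j * q = 1 / 2`. Squaring gives the bound `1 / 4` for missing
  -- `S`.
  have hhalf : (1 / 2 : ℝ) ≤ (1 - q) ^ 2 ^ j := by
    have := one_add_mul_le_pow (a := -q) (by linarith) (2 ^ j)
    push_cast at this
    rw [← sub_eq_add_neg] at this
    linarith
  have hA : (1 / 4 : ℝ) ≤ (1 - q) ^ S.card := by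
    refine le_trans ?_ (pow_le_pow_of_le_one (by linarith) (by linarith) hS.le)
    rw [pow_succ 2 j, pow_mul]
    nlinarith
  have hB : (1 - q) ^ T.card ≤ 2 / 3 := by
    refine le_trans (pow_le_pow_of_le_one (by linarith) (by linarith) hT) ?_
    -- Here `(1 + q) ^ 2 ^ j ≥ 3 / 2`, while its product with `(1 - q) ^ 2 ^ j` is at most `1`.
    have h1 := one_add_mul_le_pow (a := q) (by linarith) (2 ^ j)
    push_cast at h1
    have h2 : (1 - q) ^ 2 ^ j * (1 + q) ^ 2 ^ j ≤ 1 := by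
      rw [← mul_pow]
      exact pow_le_one₀ (by nlinarith) (by nlinarith)
    have h3 : 0 ≤ (1 - q) ^ 2 ^ j := by linarith
    nlinarith
  have hcard : (Fintype.card (P → Fin (2 ^ n)) : ℝ)
      = ((2 ^ n : ℕ) : ℝ) ^ Fintype.card P := by
    rw [Fintype.card_fun, Fintype.card_fin]
    push_cast
    rfl
  push_cast at hsplit' hcard
  rw [hcard]
  set N : ℝ := ((2 : ℝ) ^ n) ^ Fintype.card P with hN
  have hNpos : 0 < N := by positivity
  have hkey : (1 : ℝ) / 12 ≤ (1 - q) ^ S.card * (1 - (1 - q) ^ T.card) := by nlinarith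
  nlinarith

end RandomSets

/-! ### The random embedding and its distortion. -/

section Embedding

variable {P : Type*}

/-- The subset of `P` of density `2 ^ (-(j + 1))` selected by the labelling `ω`. -/
def labelSet {n : ℕ} (ω : P → Fin (2 ^ n)) (j : ℕ) : Set P :=
  {z | (ω z : ℕ) < 2 ^ (n - (j + 1))}

variable [MetricSpace P]

/-- The differences of the distances of `x` and `y` to the sets selected by `ω`. -/
noncomputable def distDiff {n m : ℕ} (ω : Fin m → P → Fin (2 ^ n)) (x y : P)
    (i : Fin n × Fin m) : ℝ :=
  Metric.infDist x (labelSet (ω i.2) i.1) - Metric.infDist y (labelSet (ω i.2) i.1)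

lemma sub_le_infDist_sub_infDist {A : Set P} {x y : P} {r s : ℝ}
    (hx : ∀ z, dist x z < s → z ∉ A) (hy : ∃ z ∈ A, dist y z ≤ r) :
    s - r ≤ Metric.infDist x A - Metric.infDist y A := by
  obtain ⟨z, hzA, hz⟩ := hy
  have h1 : s ≤ Metric.infDist x A :=
    (Metric.le_infDist ⟨z, hzA⟩).2 fun {w} hw => not_lt.1 fun h => hx w h hw
  have h2 := (Metric.infDist_le_dist_of_mem (x := y) hzA).trans hz
  linarith

/-- A random coordinate: a signed sum of distances to the sets selected by the labellings. -/
noncomputable def randomCoord {n m : ℕ}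
    (p : (Fin m → P → Fin (2 ^ n)) × Finset (Fin n × Fin m)) (x : P) : ℝ :=
  signedSum Finset.univ (fun i => Metric.infDist x (labelSet (p.1 i.2) i.1)) p.2

lemma randomCoord_sub {n m : ℕ}
    (p : (Fin m → P → Fin (2 ^ n)) × Finset (Fin n × Fin m)) (x y : P) :
    randomCoord p x - randomCoord p y = signedSum Finset.univ (distDiff p.1 x y) p.2 := by
  simp only [randomCoord, signedSum, distDiff]
  rw [← Finset.sum_sub_distrib]
  refine Finset.sum_congr rfl fun i _ => ?_
  split_ifs <;> ring

lemma abs_randomCoord_sub_le {n m : ℕ}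
    (p : (Fin m → P → Fin (2 ^ n)) × Finset (Fin n × Fin m)) (x y : P) :
    |randomCoord p x - randomCoord p y| ≤ m * n * dist x y := by
  rw [randomCoord_sub, signedSum]
  refine (Finset.abs_sum_le_sum_abs _ _).trans ?_
  have h : ∀ i ∈ (Finset.univ : Finset (Fin n × Fin m)),
      |if i ∈ p.2 then distDiff p.1 x y i else -distDiff p.1 x y i| ≤ dist x y := by
    intro i _
    have h1 : |distDiff p.1 x y i| ≤ dist x y := by
      -- An empty label set does no harm: `Metric.infDist` is then constantly zero.
      have := (Metric.lipschitz_infDist_pt (labelSet (p.1 i.2) i.1)).dist_le_mul x y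
      simpa [Real.dist_eq, distDiff] using this
    split_ifs
    · exact h1
    · rwa [abs_neg]
  refine (Finset.sum_le_card_nsmul _ _ _ h).trans (le_of_eq ?_)
  rw [Finset.card_univ, Fintype.card_prod, Fintype.card_fin, Fintype.card_fin, nsmul_eq_mul]
  push_cast
  ring

lemma card_filter_forall_not_le {Ω : Type*} [Fintype Ω] (p : Ω → Prop) [DecidablePred p]
    (h : (Fintype.card Ω : ℝ) ≤ 12 * (Finset.univ.filter p).card) (m : ℕ) :
    ((Finset.univ.filter fun ω : Fin m → Ω => ∀ b, ¬ p (ω b)).card : ℝ) ≤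
      (11 / 12) ^ m * Fintype.card (Fin m → Ω) := by
  classical
  have hset : (Finset.univ.filter fun ω : Fin m → Ω => ∀ b, ¬ p (ω b))
      = Fintype.piFinset fun _ => Finset.univ.filter fun v => ¬ p v := by
    ext ω
    simp [Fintype.mem_piFinset]
  have hsplit := Finset.card_filter_add_card_filter_not (s := (Finset.univ : Finset Ω)) p
  have hsplit' := congrArg (Nat.cast (R := ℝ)) hsplit
  rw [Finset.card_univ] at hsplit'
  push_cast at hsplit'
  rw [hset, Fintype.card_piFinset, Fintype.card_fun, Finset.prod_const, Finset.card_univ,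
    Fintype.card_fin]
  push_cast
  rw [← mul_pow]
  exact pow_le_pow_left₀ (by positivity) (by linarith) m

section Counting

variable [Fintype P] [DecidableEq P]

/-- The condition `r + s ≤ dist x y` makes the two balls disjoint; a set that misses the open one
and meets the closed one separates the two distances by `s - r`. -/
lemma card_le_twelve_mul_card_separating {n j : ℕ} (hj : j < n) {x y : P} {r s : ℝ}
    (hrs : r + s ≤ dist x y)
    (hball : (Finset.univ.filter fun z => dist x z < s).card < 2 ^ (j + 1))
    (hcball : 2 ^ j ≤ (Finset.univ.filter fun z => dist y z ≤ r).card) :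
    (Fintype.card (P → Fin (2 ^ n)) : ℝ) ≤
      12 * (Finset.univ.filter fun ω : P → Fin (2 ^ n) =>
        s - r ≤ |Metric.infDist x (labelSet ω j) - Metric.infDist y (labelSet ω j)|).card := by
  classical
  have hdisj : Disjoint (Finset.univ.filter fun z => dist x z < s)
      (Finset.univ.filter fun z => dist y z ≤ r) := by
    rw [Finset.disjoint_left]
    intro z hz hz'
    rw [Finset.mem_filter] at hz hz'
    have := dist_triangle_right x y z
    linarith [hz.2, hz'.2]
  refine (card_le_twelve_mul_card_miss_hit hj hdisj hball hcball).trans ?_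
  gcongr with ω
  rintro ⟨h1, z, hz, hzω⟩
  refine (sub_le_infDist_sub_infDist (fun w hw hwA => ?_) ⟨z, hzω, ?_⟩).trans (le_abs_self _)
  · exact absurd hwA (not_lt.2 (h1 w (by simpa using hw)))
  · simpa using hz

/-- For at least four fifths of the labellings, the distance differences of a given pair have a
large sum of squares. -/
lemma card_filter_sum_distDiff_sq_ge {n : ℕ} (hn : 1 ≤ n) (hP : Fintype.card P ≤ 2 ^ n)
    {x y : P} (hxy : x ≠ y) :
    (4 / 5 : ℝ) * Fintype.card (Fin 32 → P → Fin (2 ^ n)) ≤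
      (Finset.univ.filter fun ω : Fin 32 → P → Fin (2 ^ n) =>
        dist x y ^ 2 / (8 * n) ≤ ∑ i, distDiff ω x y i ^ 2).card := by
  classical
  obtain ⟨r, hr0, hrn, hmono, hcap, hclosed, hopen⟩ := exists_bourgain_radii hP hxy
  have hd : 0 < dist x y := dist_pos.2 hxy
  have hn' : (0 : ℝ) < n := by exact_mod_cast hn
  let δ : Fin n → ℝ := fun j => r (j + 1) - r j
  have hδ0 : ∀ j, 0 ≤ δ j := fun j => sub_nonneg.2 (hmono (Nat.le_succ _))
  have hδsum : ∑ j, δ j = dist x y / 2 := by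
    rw [Fin.sum_univ_eq_sum_range (fun j => r (j + 1) - r j) n, Finset.sum_range_sub, hr0, hrn,
      sub_zero]
  set Δ : ℝ := ∑ j, δ j ^ 2 with hΔ
  have hΔge : dist x y ^ 2 / (4 * n) ≤ Δ := by
    have := sq_sum_le_card_mul_sum_sq (s := (Finset.univ : Finset (Fin n))) (f := δ)
    rw [hδsum, Finset.card_univ, Fintype.card_fin] at this
    rw [div_le_iff₀ (by positivity)]
    linarith
  have hΔpos : 0 < Δ := lt_of_lt_of_le (by positivity) hΔge
  let p : Fin n → (P → Fin (2 ^ n)) → Prop := fun j ω =>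
    δ j ≤ |Metric.infDist x (labelSet ω j) - Metric.infDist y (labelSet ω j)|
  have hp : ∀ j, (Fintype.card (P → Fin (2 ^ n)) : ℝ) ≤ 12 * (Finset.univ.filter (p j)).card := by
    intro j
    -- Once the radius has reached its cap, `δ j ≤ 0` and the event is certain.
    rcases (hcap j).eq_or_lt with heq | hlt
    · have hall : Finset.univ.filter (p j) = Finset.univ := by
        refine Finset.filter_true_of_mem fun ω _ => ?_
        have : δ j ≤ 0 := by
          have := hcap (j + 1)
          simp only [δ]; linarith
        exact this.trans (abs_nonneg _)
      rw [hall, Finset.card_univ]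
      have : (0 : ℝ) ≤ Fintype.card (P → Fin (2 ^ n)) := by positivity
      linarith
    · have hrs : r j + r (j + 1) ≤ dist x y := by linarith [hcap j, hcap (j + 1)]
      rcases hopen (j + 1) with h | h
      · exact card_le_twelve_mul_card_separating j.2 hrs h (hclosed j hlt).2
      · have := card_le_twelve_mul_card_separating j.2 (dist_comm x y ▸ hrs) h (hclosed j hlt).1
        simpa only [p, δ, abs_sub_comm] using this
  set N : ℝ := ((Fintype.card (Fin 32 → P → Fin (2 ^ n)) : ℕ) : ℝ) with hN
  have hN0 : 0 ≤ N := by positivity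
  have hmiss : ∀ j, ((Finset.univ.filter fun ω : Fin 32 → P → Fin (2 ^ n) =>
      ∀ b, ¬ p j (ω b)).card : ℝ) ≤ N / 10 := by
    intro j
    refine (card_filter_forall_not_le (p j) (hp j) 32).trans ?_
    rw [← hN]
    have : ((11 : ℝ) / 12) ^ 32 ≤ 1 / 10 := by norm_num
    nlinarith
  -- Only the squares at scales missed by all `32` labellings can be lost. Their mean is at most `Δ
  -- / 10`, so by Markov more than `Δ / 2` is lost with probability at most `1 / 5`. No independence
  -- between scales is needed.
  have hlow : ∀ ω : Fin 32 → P → Fin (2 ^ n),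
      Δ ≤ ∑ i, distDiff ω x y i ^ 2 + ∑ j, if ∀ b, ¬ p j (ω b) then δ j ^ 2 else 0 := by
    intro ω
    rw [Fintype.sum_prod_type, ← Finset.sum_add_distrib]
    refine Finset.sum_le_sum fun j _ => ?_
    have hnonneg : 0 ≤ ∑ b, distDiff ω x y (j, b) ^ 2 :=
      Finset.sum_nonneg fun _ _ => sq_nonneg _
    split_ifs with hj
    · linarith
    · push Not at hj
      obtain ⟨b, hb⟩ := hj
      have h1 : δ j ^ 2 ≤ distDiff ω x y (j, b) ^ 2 := by
        rw [← sq_abs (distDiff ω x y (j, b))]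
        exact pow_le_pow_left₀ (hδ0 j) hb 2
      have h2 := Finset.single_le_sum (f := fun b => distDiff ω x y (j, b) ^ 2)
        (fun _ _ => sq_nonneg _) (Finset.mem_univ b)
      linarith
  have hmarkov : ∑ ω : Fin 32 → P → Fin (2 ^ n),
      ∑ j, (if ∀ b, ¬ p j (ω b) then δ j ^ 2 else 0) ≤ N / 10 * Δ := by
    rw [Finset.sum_comm, hΔ, Finset.mul_sum]
    refine Finset.sum_le_sum fun j _ => ?_
    rw [← Finset.sum_filter, Finset.sum_const, nsmul_eq_mul]
    exact mul_le_mul_of_nonneg_right (hmiss j) (sq_nonneg _)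
  set Gd := Finset.univ.filter fun ω : Fin 32 → P → Fin (2 ^ n) =>
        dist x y ^ 2 / (8 * n) ≤ ∑ i, distDiff ω x y i ^ 2 with hGd
  set Bd := Finset.univ.filter fun ω : Fin 32 → P → Fin (2 ^ n) =>
        ¬ dist x y ^ 2 / (8 * n) ≤ ∑ i, distDiff ω x y i ^ 2 with hBd
  have hbad : (Bd.card : ℝ) * (Δ / 2) ≤ N / 10 * Δ := by
    refine le_trans ?_ hmarkov
    rw [← nsmul_eq_mul, ← Finset.sum_const]
    have hnn : ∀ ω : Fin 32 → P → Fin (2 ^ n),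
        0 ≤ ∑ j, (if ∀ b, ¬ p j (ω b) then δ j ^ 2 else 0) := fun ω =>
      Finset.sum_nonneg fun j _ => by split_ifs <;> positivity
    refine (Finset.sum_le_sum fun ω hω => ?_).trans
      (Finset.sum_le_sum_of_subset_of_nonneg (Finset.subset_univ Bd) fun ω _ _ => hnn ω)
    have h1 := (Finset.mem_filter.1 hω).2
    have h2 := hlow ω
    have h3 : dist x y ^ 2 / (8 * n) = dist x y ^ 2 / (4 * n) / 2 := by
      field_simp
      norm_num
    rw [h3] at h1
    linarith
  have hsplit := Finset.card_filter_add_card_filter_not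
    (s := (Finset.univ : Finset (Fin 32 → P → Fin (2 ^ n))))
    (fun ω => dist x y ^ 2 / (8 * n) ≤ ∑ i, distDiff ω x y i ^ 2)
  have hsplit' := congrArg (Nat.cast (R := ℝ)) hsplit
  rw [← hGd, ← hBd, Finset.card_univ, ← hN, Nat.cast_add] at hsplit'
  have : (Bd.card : ℝ) ≤ N / 5 := by
    refine le_of_mul_le_mul_right ?_ hΔpos
    linarith
  linarith

/-- Good labellings have probability at least `4 / 5`, and for each of them good signs have
probability at least `1 / 12`; the product is `1 / 15`. -/
lemma card_filter_randomCoord_small_le {n : ℕ} (hn : 1 ≤ n) (hP : Fintype.card P ≤ 2 ^ n)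
    {x y : P} (hxy : x ≠ y) :
    ((Finset.univ.filter fun p : (Fin 32 → P → Fin (2 ^ n)) × Finset (Fin n × Fin 32) =>
      ¬ dist x y ^ 2 / (16 * n) ≤ (randomCoord p x - randomCoord p y) ^ 2).card : ℝ) ≤
      14 / 15 * Fintype.card ((Fin 32 → P → Fin (2 ^ n)) × Finset (Fin n × Fin 32)) := by
  classical
  set Gd := Finset.univ.filter fun ω : Fin 32 → P → Fin (2 ^ n) =>
        dist x y ^ 2 / (8 * n) ≤ ∑ i, distDiff ω x y i ^ 2 with hGd
  have hG := card_filter_sum_distDiff_sq_ge hn hP hxy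
  rw [← hGd] at hG
  set good := Finset.univ.filter fun p : (Fin 32 → P → Fin (2 ^ n)) × Finset (Fin n × Fin 32) =>
      dist x y ^ 2 / (16 * n) ≤ (randomCoord p x - randomCoord p y) ^ 2 with hgood
  have hsub : Gd.sigma (fun ω => Finset.univ.filter fun T : Finset (Fin n × Fin 32) =>
      (∑ i, distDiff ω x y i ^ 2) / 2 ≤ signedSum Finset.univ (distDiff ω x y) T ^ 2)
      ⊆ good.map (Equiv.sigmaEquivProd _ _).symm.toEmbedding := by
    rintro ⟨ω, T⟩ h
    simp only [Finset.mem_sigma, hGd, Finset.mem_filter, Finset.mem_univ, true_and] at h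
    refine Finset.mem_map.2 ⟨(ω, T), ?_, rfl⟩
    rw [hgood, Finset.mem_filter, randomCoord_sub]
    refine ⟨Finset.mem_univ _, le_trans (le_trans (le_of_eq ?_)
      (div_le_div_of_nonneg_right h.1 zero_le_two)) h.2⟩
    ring
  have hcard := Finset.card_le_card hsub
  rw [Finset.card_sigma, Finset.card_map] at hcard
  have hcard' := (Nat.cast_le (α := ℝ)).2 hcard
  push_cast at hcard'
  set M : ℝ := ((Fintype.card (Finset (Fin n × Fin 32)) : ℕ) : ℝ) with hM
  have hM0 : 0 ≤ M := by positivity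
  have hlow : (Gd.card : ℝ) * (M / 12) ≤ good.card := by
    refine le_trans ?_ hcard'
    rw [← nsmul_eq_mul, ← Finset.sum_const]
    refine Finset.sum_le_sum fun ω _ => ?_
    have := card_le_twelve_mul_card_signedSum_sq_ge (distDiff ω x y)
    rw [← hM] at this
    linarith
  have hsplit := Finset.card_filter_add_card_filter_not
    (s := (Finset.univ : Finset ((Fin 32 → P → Fin (2 ^ n)) × Finset (Fin n × Fin 32))))
    (fun p => dist x y ^ 2 / (16 * n) ≤ (randomCoord p x - randomCoord p y) ^ 2)
  have hsplit' := congrArg (Nat.cast (R := ℝ)) hsplit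
  rw [← hgood, Finset.card_univ, Nat.cast_add, Fintype.card_prod, Nat.cast_mul, ← hM] at hsplit'
  rw [Fintype.card_prod, Nat.cast_mul, ← hM]
  nlinarith

end Counting

/-- Every metric space with at most `2 ^ n` points embeds into `ℓ_∞^{26 n}` with distortion of
order `n ^ (3 / 2)`. -/
theorem exists_embedding_pi [Fintype P] {n : ℕ} (hn : 1 ≤ n) (hP : Fintype.card P ≤ 2 ^ n) :
    ∃ F : P → Fin (26 * n) → ℝ, (∀ x y, dist (F x) (F y) ≤ 32 * n * dist x y) ∧
      ∀ x y, dist x y ≤ 4 * √n * dist (F x) (F y) := by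
  classical
  have hn' : (0 : ℝ) < n := by exact_mod_cast hn
  let Ω := (Fin 32 → P → Fin (2 ^ n)) × Finset (Fin n × Fin 32)
  have hΩ : Nonempty Ω := ⟨(fun _ _ => ⟨0, by positivity⟩, ∅)⟩
  obtain ⟨ω, hω⟩ := exists_forall_exists_notMem (Ω := Ω)
    (Finset.univ.filter fun q : P × P => q.1 ≠ q.2)
    (fun q => Finset.univ.filter fun p : Ω =>
      ¬ dist q.1 q.2 ^ 2 / (16 * n) ≤ (randomCoord p q.1 - randomCoord p q.2) ^ 2)
    (14 / 15) (26 * n)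
    (fun q hq => card_filter_randomCoord_small_le hn hP (Finset.mem_filter.1 hq).2) (by
      have h1 : ((Finset.univ.filter fun q : P × P => q.1 ≠ q.2).card : ℝ) ≤ 4 ^ n := by
        have h2 : (Finset.univ.filter fun q : P × P => q.1 ≠ q.2).card ≤ 4 ^ n := by
          refine (Finset.card_le_univ _).trans ?_
          rw [Fintype.card_prod]
          calc _ ≤ 2 ^ n * 2 ^ n := Nat.mul_le_mul hP hP
            _ = 4 ^ n := by rw [← mul_pow]; norm_num
        exact_mod_cast h2
      -- There are at most `4 ^ n` pairs, so `26` trials per unit of `n` are enough.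
      have h3 : (14 / 15 : ℝ) ^ 26 * 4 < 1 := by norm_num
      calc _ ≤ (4 : ℝ) ^ n * (14 / 15) ^ (26 * n) := by gcongr
        _ = ((14 / 15 : ℝ) ^ 26 * 4) ^ n := by rw [mul_pow, ← pow_mul, mul_comm]
        _ < 1 := pow_lt_one₀ (by positivity) h3 (by omega))
  refine ⟨fun x k => randomCoord (ω k) x, fun x y => ?_, fun x y => ?_⟩
  · refine (dist_pi_le_iff (by positivity)).2 fun k => ?_
    rw [Real.dist_eq]
    exact_mod_cast abs_randomCoord_sub_le (ω k) x y
  · rcases eq_or_ne x y with rfl | hxy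
    · simp
    obtain ⟨k, hk⟩ := hω (x, y) (by simpa using hxy)
    simp only [Finset.mem_filter, Finset.mem_univ, true_and, not_not] at hk
    have h1 : dist x y ≤ 4 * √n * |randomCoord (ω k) x - randomCoord (ω k) y| := by
      refine abs_le_of_sq_le_sq' ?_ (by positivity) |>.2
      rw [mul_pow, mul_pow, sq_abs, Real.sq_sqrt hn'.le]
      rw [div_le_iff₀ (by positivity)] at hk
      linarith
    refine h1.trans (mul_le_mul_of_nonneg_left ?_ (by positivity))
    exact dist_le_pi_dist (fun k => randomCoord (ω k) x) (fun k => randomCoord (ω k) y) k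

end Embedding

/-! ### Finite nets from entropy numbers. -/

section Nets

variable {X : Type*} [MetricSpace X]

/-- A set that is covered by `2 ^ n` balls of arbitrarily small radius has at most `2 ^ n` points. -/
lemma encard_le_of_forall_covered {n : ℕ} {K : Set X}
    (h : ∀ δ > 0, ∃ ε < δ, ∃ c : Fin (2 ^ n) → X, K ⊆ ⋃ i, Metric.closedBall (c i) ε) :
    K.encard ≤ 2 ^ n := by
  classical
  by_contra! hlt
  have hlt' : ((2 ^ n + 1 : ℕ) : ℕ∞) ≤ K.encard := by
    have := Order.add_one_le_of_lt hlt
    exact_mod_cast this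
  obtain ⟨T, hTK, hT⟩ := Set.exists_subset_encard_eq hlt'
  have hTfin : T.Finite := Set.finite_of_encard_eq_coe hT
  have hTcard : hTfin.toFinset.card = 2 ^ n + 1 := by
    rw [hTfin.encard_eq_coe_toFinset_card] at hT
    exact_mod_cast hT
  obtain ⟨δ, hδ, hsep⟩ : ∃ δ > 0, ∀ x ∈ T, ∀ y ∈ T, x ≠ y → δ ≤ dist x y := by
    rcases (hTfin.toFinset.offDiag).eq_empty_or_nonempty with h0 | h0
    · refine ⟨1, one_pos, fun x hx y hy hxy => ?_⟩
      have : (x, y) ∈ hTfin.toFinset.offDiag := by simp [hx, hy, hxy]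
      simp [h0] at this
    · obtain ⟨q, hq, hmin⟩ := Finset.exists_min_image _ (fun q : X × X => dist q.1 q.2) h0
      refine ⟨dist q.1 q.2, dist_pos.2 (Finset.mem_offDiag.1 hq).2.2, fun x hx y hy hxy => ?_⟩
      exact hmin (x, y) (by simp [hx, hy, hxy])
  obtain ⟨ε, hε, c, hc⟩ := h (δ / 2) (by positivity)
  have hmem : ∀ x ∈ T, ∃ i, dist x (c i) ≤ ε := fun x hx => by
    simpa using hc (hTK hx)
  choose! i hi using hmem
  obtain ⟨x, hx, y, hy, hxy, heq⟩ := Finset.exists_ne_map_eq_of_card_lt_of_maps_to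
    (s := hTfin.toFinset) (t := (Finset.univ : Finset (Fin (2 ^ n)))) (f := i)
    (by rw [hTcard, Finset.card_univ, Fintype.card_fin]; omega) (fun _ _ => Finset.mem_univ _)
  rw [hTfin.mem_toFinset] at hx hy
  have h1 := hsep x hx y hy hxy
  have h2 := dist_triangle_right x y (c (i x))
  have h3 := hi x hx
  have h4 := hi y hy
  rw [← heq] at h4
  linarith

lemma exists_finite_net {n : ℕ} {K : Set X} (hK : IsCompact K) :
    ∃ S : Set X, S.encard ≤ 2 ^ n ∧ ∀ f ∈ K, ∃ c ∈ S, dist f c ≤ 2 * entropyNumber n K := by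
  set E := {ε : ℝ | 0 < ε ∧ ∃ c : Fin (2 ^ n) → X, K ⊆ ⋃ i, Metric.closedBall (c i) ε} with hE
  have hent : entropyNumber n K = sInf E := rfl
  rcases K.eq_empty_or_nonempty with rfl | ⟨x₀, hx₀⟩
  · exact ⟨∅, by simp, by simp⟩
  have hne : E.Nonempty := by
    obtain ⟨ρ, hρ⟩ := hK.isBounded.subset_closedBall x₀
    refine ⟨max ρ 1, by positivity, fun _ => x₀, fun z hz => ?_⟩
    exact Set.mem_iUnion.2 ⟨⟨0, by positivity⟩,
      Metric.closedBall_subset_closedBall (le_max_left _ _) (hρ hz)⟩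
  have h0 : 0 ≤ sInf E := Real.sInf_nonneg fun ε hε => hε.1.le
  -- If the infimum is zero, doubling it leaves no room for an admissible radius; `K` is then finite
  -- and serves as its own net.
  rcases h0.eq_or_lt with hzero | hpos
  · refine ⟨K, encard_le_of_forall_covered fun δ hδ => ?_, fun f hf => ⟨f, hf, ?_⟩⟩
    · obtain ⟨ε, hε, hlt⟩ := exists_lt_of_csInf_lt hne (hzero ▸ hδ)
      exact ⟨ε, hlt, hε.2⟩
    · rw [dist_self, hent]; positivity
  · obtain ⟨ε, ⟨_, c, hc⟩, hlt⟩ := exists_lt_of_csInf_lt hne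
      (show sInf E < 2 * sInf E by linarith)
    refine ⟨Set.range c, ?_, fun f hf => ?_⟩
    · rw [← Set.image_univ]
      refine (Set.encard_image_le _ _).trans (le_of_eq ?_)
      rw [Set.encard_univ]
      simp
    · obtain ⟨i, hi⟩ := Set.mem_iUnion.1 (hc hf)
      exact ⟨c i, ⟨i, rfl⟩, (Metric.mem_closedBall.1 hi).trans (hent ▸ hlt.le)⟩

end Nets

/-! ### Lipschitz extension and the final estimate. -/

/-- A finite set of at most `2 ^ n` points in a space isometric to `ℓ_∞(Γ)` factors through
`ℓ_∞^{26 n}` by globally defined Lipschitz maps. -/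
lemma exists_lipschitz_factorization {X Γ : Type*} [MetricSpace X]
    (e : X ≃ᵢ lp (fun _ : Γ => ℝ) ∞) {n : ℕ} (hn : 1 ≤ n) {S : Set X} (hS : S.encard ≤ 2 ^ n) :
    ∃ (a : X → (Fin (26 * n) → ℝ)) (M : (Fin (26 * n) → ℝ) → X),
      LipschitzWith (32 * (n : ℝ≥0) ^ (3 / 4 : ℝ)) a ∧
      LipschitzWith (4 * (n : ℝ≥0) ^ (3 / 4 : ℝ)) M ∧ ∀ x ∈ S, M (a x) = x := by
  classical
  have hSfin : S.Finite := Set.finite_of_encard_le_coe (k := 2 ^ n) (by exact_mod_cast hS)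
  have := hSfin.fintype
  have : Nonempty X := ⟨e.symm 0⟩
  have hcard : Fintype.card S ≤ 2 ^ n := by
    rw [← ENat.card_coe_set_eq, ENat.card_eq_coe_fintype_card] at hS
    exact_mod_cast hS
  obtain ⟨F, hup, hlow⟩ := exists_embedding_pi hn hcard
  have hn' : (0 : ℝ) < n := by exact_mod_cast hn
  -- Rescaling by `w⁻¹` balances the constants `32 * n` and `4 * √n`: both become multiples of `n ^
  -- (3 / 4)`.
  set w : ℝ := (n : ℝ) ^ (1 / 4 : ℝ) with hw
  have hwpos : 0 < w := by positivity
  have hw4 : (n : ℝ) = w ^ 4 := by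
    rw [hw, ← Real.rpow_natCast, ← Real.rpow_mul hn'.le]; norm_num
  have hw2 : √(n : ℝ) = w ^ 2 := by
    rw [hw4, show w ^ 4 = (w ^ 2) ^ 2 by ring, Real.sqrt_sq (by positivity)]
  have hw3 : (n : ℝ) ^ (3 / 4 : ℝ) = w ^ 3 := by
    rw [hw, ← Real.rpow_natCast, ← Real.rpow_mul hn'.le]; norm_num
  let a₀ : X → Fin (26 * n) → ℝ := fun x => if h : x ∈ S then w⁻¹ • F ⟨x, h⟩ else 0
  have ha₀ : ∀ x y : S, dist (a₀ x) (a₀ y) = w⁻¹ * dist (F x) (F y) := by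
    intro x y
    simp only [a₀, x.2, y.2, dif_pos, Subtype.coe_eta]
    rw [dist_smul₀, Real.norm_of_nonneg (by positivity)]
  have hlow' : ∀ x ∈ S, ∀ y ∈ S, dist x y ≤ 4 * w ^ 3 * dist (a₀ x) (a₀ y) := by
    intro x hx y hy
    rw [ha₀ ⟨x, hx⟩ ⟨y, hy⟩]
    refine (hlow ⟨x, hx⟩ ⟨y, hy⟩).trans (le_of_eq ?_)
    rw [hw2]
    field_simp
  have hinj : Set.InjOn a₀ S := by
    intro x hx y hy hxy
    have := hlow' x hx y hy
    rw [hxy, dist_self, mul_zero] at this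
    exact dist_le_zero.1 this
  have hlipa : LipschitzOnWith (32 * (n : ℝ≥0) ^ (3 / 4 : ℝ)) a₀ S := by
    refine LipschitzOnWith.of_dist_le_mul fun x hx y hy => ?_
    rw [ha₀ ⟨x, hx⟩ ⟨y, hy⟩]
    push_cast
    rw [hw3]
    refine (mul_le_mul_of_nonneg_left (hup ⟨x, hx⟩ ⟨y, hy⟩) (by positivity)).trans (le_of_eq ?_)
    rw [hw4, Subtype.dist_eq]
    field_simp
  have hinv : ∀ x ∈ S, Function.invFunOn a₀ S (a₀ x) = x := fun x hx => hinj.leftInvOn_invFunOn hx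
  have hlipM : LipschitzOnWith (4 * (n : ℝ≥0) ^ (3 / 4 : ℝ))
      (fun v => e (Function.invFunOn a₀ S v)) (a₀ '' S) := by
    refine LipschitzOnWith.of_dist_le_mul ?_
    rintro _ ⟨x, hx, rfl⟩ _ ⟨y, hy, rfl⟩
    rw [e.dist_eq, hinv x hx, hinv y hy]
    push_cast
    rw [hw3]
    exact hlow' x hx y hy
  obtain ⟨a, ha, haeq⟩ := hlipa.extend_pi
  obtain ⟨M, hM, hMeq⟩ := hlipM.extend_lp_infty
  refine ⟨a, e.symm ∘ M, ha, ?_, fun x hx => ?_⟩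
  · simpa using e.symm.isometry.lipschitz.comp hM
  · rw [Function.comp_apply, ← haeq hx, ← hMeq ⟨x, hx, rfl⟩]
    simp only [hinv x hx, e.symm_apply_apply]

theorem lemma5p3 :
    ∃ C : ℝ≥0, 0 < C ∧
      ∀ (X : Type*) [NormedAddCommGroup X] [NormedSpace ℝ X] [CompleteSpace X] (Γ : Type*),
        Nonempty (X ≃ᵢ lp (fun _ : Γ => ℝ) ∞) →
        ∀ K : Set X, IsCompact K →
          ∀ n : ℕ, 1 ≤ n →
            ∃ (a : X → (Fin (26 * n) → ℝ)) (M : (Fin (26 * n) → ℝ) → X),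
              LipschitzWith (C * (n : ℝ≥0) ^ (3 / 4 : ℝ)) a ∧
              LipschitzWith (C * (n : ℝ≥0) ^ (3 / 4 : ℝ)) M ∧
              ∀ f ∈ K, ‖f - M (a f)‖ ≤ (C : ℝ) * (n : ℝ) ^ (3 / 2 : ℝ) * entropyNumber n K := by
  -- `258 = 2 * (1 + 32 * 4)`: the net costs the factor `2`, the triangle inequality the summand
  -- `1`.
  refine ⟨258, by norm_num, ?_⟩
  rintro X _ _ _ Γ ⟨e⟩ K hK n hn
  obtain ⟨S, hS, hnet⟩ := exists_finite_net (n := n) hK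
  obtain ⟨a, M, ha, hM, hMa⟩ := exists_lipschitz_factorization e hn hS
  refine ⟨a, M, ha.weaken (by gcongr; norm_num), hM.weaken (by gcongr; norm_num),
    fun f hf => ?_⟩
  obtain ⟨c, hc, hfc⟩ := hnet f hf
  have hn' : (1 : ℝ) ≤ n := by exact_mod_cast hn
  have hcomp : dist (M (a c)) (M (a f)) ≤ 128 * (n : ℝ) ^ (3 / 2 : ℝ) * dist c f := by
    refine ((hM.comp ha).dist_le_mul c f).trans (le_of_eq ?_)
    push_cast
    rw [show (3 / 2 : ℝ) = 3 / 4 + 3 / 4 by norm_num, Real.rpow_add (by positivity)]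
    ring
  rw [hMa c hc, dist_comm c f] at hcomp
  have hone : (1 : ℝ) ≤ (n : ℝ) ^ (3 / 2 : ℝ) := Real.one_le_rpow hn' (by norm_num)
  have htri := dist_triangle f c (M (a f))
  have hd : 0 ≤ dist f c := dist_nonneg
  rw [← dist_eq_norm]
  calc dist f (M (a f)) ≤ 129 * (n : ℝ) ^ (3 / 2 : ℝ) * dist f c := by nlinarith
    _ ≤ 129 * (n : ℝ) ^ (3 / 2 : ℝ) * (2 * entropyNumber n K) := by gcongr
    _ = ((258 : ℝ≥0) : ℝ) * (n : ℝ) ^ (3 / 2 : ℝ) * entropyNumber n K := by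
      push_cast
      ring
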